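/- Let $n\ge 2$. For $z\in\mathbb C^n$ let $\mathbf s(z)=(s_1(z),\dots,s_n(z))$ be the vector of elementary symmetric polynomials, $\Gamma_n=\mathbf s(\overline{\mathbb D}^n)$ and $b\Gamma_n=\mathbf s(\mathbb T^n)$. A commuting tuple $(S_1,\dots,S_n)$ of bounded operators on a complex Hilbert space is a *$\Gamma_n$-contraction* if $\Gamma_n$ is a spectral set for it, i.e. its (Taylor) joint spectrum lies in $\Gamma_n$ and there is a unital algebra homomorphism $\rho$, with $z_i\mapsto S_i$, from the algebra of functions holomorphic near $\Gamma_n$ to the bounded operators such that $\|\rho(f)\|\le\sup_{\Gamma_n}|f|$ for all $f$; in particular $\|S_n\|\le 1$. A commuting tuple of normal operators whose joint spectrum lies in $b\Gamma_n$ is a *$\Gamma_n$-unitary*. Let $(S_1,\dots,S_n)$ be a $\Gamma_n$-contraction on $\mathcal H$, and let $\mathcal P_{S_n^*}$ be the positive operator on $\mathcal H$ with $\mathcal P_{S_n^*}^2=\mathrm{SOT}\text{-}\lim_k S_n^kS_n^{*k}$. The formulas $$\mathcal P_{S_n^*}h\mapsto \mathcal P_{S_n^*}S_i^*h\qquad(h\in\mathcal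 H,\ 1\le i\le n)$$ extend to well-defined bounded operators $A_1,\dots,A_n$ on $\overline{\mathrm{Ran}}\,\mathcal P_{S_n^*}$, and $A_n$ is an isometry. A *canonical $\Gamma_n$-unitary* associated with $(S_1,\dots,S_n)$ is a $\Gamma_n$-unitary $(D_1,\dots,D_n)$ on a Hilbert space $\mathscr P_{S_n^*}$ containing $\overline{\mathrm{Ran}}\,\mathcal P_{S_n^*}$ (through an isometric embedding) as a closed subspace, such that $D_i^*$ extends $A_i$ for $i=1,\dots,n$ and $D_n^*$ is the minimal unitary extension of $A_n$, i.e. $D_n^*$ is unitary and $\mathscr P_{S_n^*}$ is the smallest closed subspace that contains $\overline{\mathrm{Ran}}\,\mathcal P_{S_n^*}$ and reduces $D_n^*$. **Theorem.** Let $(D_1,\dots,D_n)$ on $\mathscr P_{S_n^*}$ and $(D_1',\dots,D_n')$ on $\mathscr P_{S_n'^*}$ be canonical $\Gamma_n$-unitaries associated with $\Gamma_n$-contractions $(S_1,\dots,S_n)$ on $\mathcal H$ and $(S_1',\dots,S_n')$ on $\mathcal H'$, respectively. Suppose that $U:\mathcal H\to\mathcal H'$ is a unitary operator with $US_i=S_i'U$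 for $i=1,\dots,n$. Then there is a unitary operator $U_D:\mathscr P_{S_n^*}\to\mathscr P_{S_n'^*}$ with $$U_D\bigl(D_n^k\,\mathcal P_{S_n^*}h\bigr)=D_n'^k\,\mathcal P_{S_n'^*}Uh\qquad\text{for all }k\ge 0,\ h\in\mathcal H,$$ it is the only bounded linear operator satisfying this formula, and $U_DD_i=D_i'U_D$ for $i=1,\dots,n$. -/

import Mathlib

open Filter Topology
open scoped InnerProduct

noncomputable section

namespace GammaN

/-! ### The symmetrized polydisc -/

/-- The symmetrization map `(z₁, …, zₙ) ↦ (s₁(z), …, sₙ(z))`; the coordinate with (zero-based) index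
`i` is the elementary symmetric polynomial of degree `i + 1`. -/
def symmetrization (n : ℕ) (z : Fin n → ℂ) : Fin n → ℂ := fun i =>
  ∑ t ∈ Finset.powersetCard (i.val + 1) (Finset.univ : Finset (Fin n)), ∏ j ∈ t, z j

/-- The closed symmetrized polydisc `Γₙ`. -/
def Gam (n : ℕ) : Set (Fin n → ℂ) :=
  symmetrization n '' {z | ∀ j, ‖z j‖ ≤ 1}

/-- The distinguished boundary `bΓₙ`. -/
def bGam (n : ℕ) : Set (Fin n → ℂ) :=
  symmetrization n '' {z | ∀ j, ‖z j‖ = 1}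

/-! ### The joint (Taylor) spectrum -/

section Spectrum

variable {n : ℕ} {H : Type*} [NormedAddCommGroup H] [InnerProductSpace ℂ H]

/-- The differential of the (total) Koszul complex `Λ(ℂⁿ) ⊗ H` of a tuple `T`. An element of
`Λ(ℂⁿ) ⊗ H` is written as `∑ₛ eₛ ⊗ x s` with `s` running over the subsets of the index set, and the
differential is `e ⊗ x ↦ ∑ᵢ (eᵢ ∧ e) ⊗ Tᵢ x`. -/
def koszulDifferential (T : Fin n → H →L[ℂ] H) (x : Finset (Fin n) → H) : Finset (Fin n) → H :=
  fun s => ∑ i ∈ s, ((-1 : ℂ) ^ (s.filter (fun j => j < i)).card) • T i (x (s.erase i))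

/-- The Taylor joint spectrum of a commuting tuple: the points `l` for which the Koszul complex of
`(T₁ - l₁, …, Tₙ - lₙ)` is not exact. -/
def jointSpectrum (T : Fin n → H →L[ℂ] H) : Set (Fin n → ℂ) :=
  {l | ¬ ∀ x : Finset (Fin n) → H,
      koszulDifferential (fun i => T i - l i • ContinuousLinearMap.id ℂ H) x = 0 →
        ∃ y : Finset (Fin n) → H,
          koszulDifferential (fun i => T i - l i • ContinuousLinearMap.id ℂ H) y = x}

end Spectrum

/-! ### Spectral sets -/

/-- The algebra `𝒪(Ω)` of functions that are holomorphic in some neighbourhood of `Ω`. -/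
def holomorphicNear {n : ℕ} (Ω : Set (Fin n → ℂ)) : Subalgebra ℂ ((Fin n → ℂ) → ℂ) where
  carrier := {f | ∃ V : Set (Fin n → ℂ), IsOpen V ∧ Ω ⊆ V ∧ DifferentiableOn ℂ f V}
  mul_mem' := by
    rintro f g ⟨V, hV, hΩV, hf⟩ ⟨W, hW, hΩW, hg⟩
    exact ⟨V ∩ W, hV.inter hW, Set.subset_inter hΩV hΩW,
      (hf.mono Set.inter_subset_left).mul (hg.mono Set.inter_subset_right)⟩
  add_mem' := by
    rintro f g ⟨V, hV, hΩV, hf⟩ ⟨W, hW, hΩW, hg⟩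
    exact ⟨V ∩ W, hV.inter hW, Set.subset_inter hΩV hΩW,
      (hf.mono Set.inter_subset_left).add (hg.mono Set.inter_subset_right)⟩
  algebraMap_mem' := by
    intro c
    exact ⟨Set.univ, isOpen_univ, Set.subset_univ _, differentiableOn_const c⟩

/-- The coordinate function `zᵢ` as an element of `𝒪(Ω)`. -/
def coordinate {n : ℕ} (Ω : Set (Fin n → ℂ)) (i : Fin n) : holomorphicNear Ω :=
  ⟨fun z => z i, Set.univ, isOpen_univ, Set.subset_univ _, by fun_prop⟩

variable {n : ℕ}
variable {H : Type*} [NormedAddCommGroup H] [InnerProductSpace ℂ H] [CompleteSpace H]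
variable {K : Type*} [NormedAddCommGroup K] [InnerProductSpace ℂ K] [CompleteSpace K]

/-- The compact set `Ω` is a spectral set for the commuting tuple `T`: the joint spectrum lies in
`Ω`, and there is a unital homomorphism `𝒪(Ω) → ℬ(H)` with `zᵢ ↦ Tᵢ` that is contractive for the
supremum norm over `Ω` on `𝒪(Ω)`. -/
structure IsSpectralSet (Ω : Set (Fin n → ℂ)) (T : Fin n → H →L[ℂ] H) : Prop where
  spectrum_subset : jointSpectrum T ⊆ Ω
  exists_contractive_hom : ∃ ρ : holomorphicNear Ω →ₐ[ℂ] (H →L[ℂ] H),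
    (∀ i, ρ (coordinate Ω i) = T i) ∧
    ∀ (f : holomorphicNear Ω) (C : ℝ), 0 ≤ C → (∀ z ∈ Ω, ‖f.1 z‖ ≤ C) → ‖ρ f‖ ≤ C

/-- `Γₙ`-contractions. -/
structure IsGammaContraction (S : Fin n → H →L[ℂ] H) : Prop where
  commute : ∀ i j, Commute (S i) (S j)
  isSpectralSet : IsSpectralSet (Gam n) S

/-- `Γₙ`-unitaries. -/
structure IsGammaUnitary (D : Fin n → K →L[ℂ] K) : Prop where
  commute : ∀ i j, Commute (D i) (D j)
  normal : ∀ i, IsStarNormal (D i)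
  spectrum_subset : jointSpectrum D ⊆ bGam n

/-- The last index of an `n`-tuple. -/
def lastIdx (n : ℕ) (hn : 2 ≤ n) : Fin n := ⟨n - 1, by omega⟩

set_option linter.unusedSectionVars false in
/-- The last operator of a `Γₙ`-contraction is a contraction. -/
theorem IsGammaContraction.norm_last_le_one {S : Fin n → H →L[ℂ] H} (hS : IsGammaContraction S)
    (hn : 2 ≤ n) : ‖S (lastIdx n hn)‖ ≤ 1 := by
  obtain ⟨ρ, hρ, hb⟩ := hS.isSpectralSet.exists_contractive_hom
  rw [← hρ]
  refine hb _ 1 zero_le_one ?_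
  rintro _ ⟨z, hz, rfl⟩
  have h1 : (lastIdx n hn).val + 1 = (Finset.univ : Finset (Fin n)).card := by
    simp only [lastIdx, Finset.card_univ, Fintype.card_fin]; omega
  have h2 : (coordinate (Gam n) (lastIdx n hn)).1 (symmetrization n z) = ∏ j, z j := by
    change symmetrization n z (lastIdx n hn) = _
    simp only [symmetrization, h1, Finset.powersetCard_self, Finset.sum_singleton]
  rw [h2, norm_prod]
  exact Finset.prod_le_one (fun _ _ => norm_nonneg _) (fun j _ => hz j)

/-! ### The operator `𝒫` of a contraction -/

/-- For a contraction `T` the sequence `T ^ k (T*) ^ k` converges strongly, and the limit is the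
square of a positive operator. -/
theorem exists_asymptoticRoot (T : H →L[ℂ] H) (hT : ‖T‖ ≤ 1) :
    ∃ P : H →L[ℂ] H, P.IsPositive ∧
      ∀ h, Tendsto (fun k : ℕ => (T ^ k * (ContinuousLinearMap.adjoint T) ^ k) h) atTop
        (𝓝 (P (P h))) := by
  set B := ContinuousLinearMap.adjoint T with hB
  have hBn : ‖B‖ ≤ 1 := by rw [hB, LinearIsometryEquiv.norm_map]; exact hT
  have hTB : ∀ k : ℕ, T ^ k = ContinuousLinearMap.adjoint (B ^ k) := by
    intro k
    rw [← ContinuousLinearMap.star_eq_adjoint, star_pow, ContinuousLinearMap.star_eq_adjoint, hB,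
      ContinuousLinearMap.adjoint_adjoint]
  have hpow : ∀ k : ℕ, ‖T ^ k‖ ≤ 1 := by
    intro k
    induction k with
    | zero => rw [pow_zero]; exact ContinuousLinearMap.norm_id_le
    | succ k ih =>
      rw [pow_succ]
      exact (norm_mul_le _ _).trans (mul_le_one₀ ih (norm_nonneg _) hT)
  -- the quadratic form of `T ^ k B ^ k`
  have hq : ∀ (k : ℕ) (x y : H), inner ℂ ((T ^ k * B ^ k) x) y = inner ℂ ((B ^ k) x) ((B ^ k) y) := by
    intro k x y
    rw [hTB k, mul_apply_eq_comp, ContinuousLinearMap.adjoint_inner_left]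
  have hanti : ∀ x : H, Antitone (fun k : ℕ => ‖(B ^ k) x‖ ^ 2) := by
    intro x
    refine antitone_nat_of_succ_le fun k => ?_
    have : ‖(B ^ (k + 1)) x‖ ≤ ‖(B ^ k) x‖ := by
      rw [pow_succ', mul_apply_eq_comp]
      exact (B.le_of_opNorm_le hBn _).trans (by simp)
    gcongr
  -- differences `‖T ^ k B ^ k x - T ^ l B ^ l x‖ ^ 2` are controlled by the quadratic form
  have hdiff : ∀ (k m : ℕ) (x : H),
      ‖(T ^ k * B ^ k) x - (T ^ (k + m) * B ^ (k + m)) x‖ ^ 2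
        ≤ ‖(B ^ k) x‖ ^ 2 - ‖(B ^ (k + m)) x‖ ^ 2 := by
    intro k m x
    set u := (B ^ k) x with hu
    have hv : (B ^ (k + m)) x = (B ^ m) u := by
      rw [add_comm, pow_add, mul_apply_eq_comp]
    have e1 : (T ^ k * B ^ k) x - (T ^ (k + m) * B ^ (k + m)) x
        = (T ^ k) (u - (T ^ m * B ^ m) u) := by
      rw [mul_apply_eq_comp, mul_apply_eq_comp, hv, pow_add,
        mul_apply_eq_comp, map_sub, mul_apply_eq_comp]
    have e2 : ‖(T ^ k) (u - (T ^ m * B ^ m) u)‖ ≤ ‖u - (T ^ m * B ^ m) u‖ := by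
      simpa using (T ^ k).le_of_opNorm_le (hpow k) (u - (T ^ m * B ^ m) u)
    have e3 : ‖(T ^ m * B ^ m) u‖ ≤ ‖(B ^ m) u‖ := by
      simpa using (T ^ m).le_of_opNorm_le (hpow m) ((B ^ m) u)
    have e4 : RCLike.re (inner ℂ u ((T ^ m * B ^ m) u)) = ‖(B ^ m) u‖ ^ 2 := by
      rw [← inner_conj_symm, RCLike.conj_re, hq]
      exact inner_self_eq_norm_sq _
    have e5 := norm_sub_sq (𝕜 := ℂ) u ((T ^ m * B ^ m) u)
    rw [e4] at e5
    have e6 : ‖(T ^ m * B ^ m) u‖ ^ 2 ≤ ‖(B ^ m) u‖ ^ 2 := by gcongr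
    rw [e1, hv]
    calc ‖(T ^ k) (u - (T ^ m * B ^ m) u)‖ ^ 2 ≤ ‖u - (T ^ m * B ^ m) u‖ ^ 2 := by gcongr
      _ ≤ ‖u‖ ^ 2 - ‖(B ^ m) u‖ ^ 2 := by rw [e5]; linarith
  have hcauchy : ∀ x : H, CauchySeq (fun k : ℕ => (T ^ k * B ^ k) x) := by
    intro x
    have hlim := tendsto_atTop_ciInf (hanti x) ⟨0, by rintro _ ⟨k, rfl⟩; positivity⟩
    have hc := hlim.cauchySeq
    rw [Metric.cauchySeq_iff'] at hc ⊢
    intro ε hε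
    obtain ⟨N, hN⟩ := hc (ε ^ 2) (by positivity)
    refine ⟨N, fun k hk => ?_⟩
    obtain ⟨m, rfl⟩ := Nat.exists_eq_add_of_le hk
    have h1 := hN (N + m) (by omega)
    rw [Real.dist_eq, abs_lt] at h1
    rw [dist_comm, dist_eq_norm]
    refine lt_of_pow_lt_pow_left₀ 2 hε.le ((hdiff N m x).trans_lt ?_)
    linarith [h1.1]
  choose a ha using fun x : H => cauchySeq_tendsto_of_complete (hcauchy x)
  let A : H →L[ℂ] H := continuousLinearMapOfTendsto (fun k : ℕ => T ^ k * B ^ k)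
    (tendsto_pi_nhds.mpr ha)
  have hA : ∀ x, A x = a x := fun x => rfl
  have hApos : A.IsPositive := by
    rw [ContinuousLinearMap.isPositive_iff_complex]
    intro x
    have hin : Tendsto (fun k : ℕ => inner ℂ ((T ^ k * B ^ k) x) x) atTop (𝓝 (inner ℂ (A x) x)) :=
      (ha x).inner tendsto_const_nhds
    have hval : ∀ k : ℕ, inner ℂ ((T ^ k * B ^ k) x) x = ((‖(B ^ k) x‖ ^ 2 : ℝ) : ℂ) := by
      intro k
      rw [hq, inner_self_eq_norm_sq_to_K]
      push_cast
      rfl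
    simp only [hval] at hin
    have hre := (Complex.continuous_re.tendsto _).comp hin
    have him := (Complex.continuous_im.tendsto _).comp hin
    have him0 : (inner ℂ (A x) x : ℂ).im = 0 := by
      refine tendsto_nhds_unique him ?_
      simp only [Function.comp_def, Complex.ofReal_im]
      exact tendsto_const_nhds
    have hre0 : 0 ≤ (inner ℂ (A x) x : ℂ).re := by
      refine ge_of_tendsto' hre fun k => ?_
      simp only [Function.comp_def, Complex.ofReal_re]
      positivity
    refine ⟨?_, hre0⟩
    apply Complex.ext
    · simp
    · simp [him0]
  have hA0 : 0 ≤ A := (ContinuousLinearMap.nonneg_iff_isPositive A).mpr hApos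
  refine ⟨CFC.sqrt A, (ContinuousLinearMap.nonneg_iff_isPositive _).mp (CFC.sqrt_nonneg A), ?_⟩
  intro h
  have h1 : CFC.sqrt A (CFC.sqrt A h) = A h := by
    rw [← mul_apply_eq_comp, CFC.sqrt_mul_sqrt_self A hA0]
  rw [h1]
  exact ha h

open Classical in
/-- The positive operator `𝒫` with `𝒫² = SOT-lim T ^ k (T*) ^ k`. It exists for every contraction,
and it is unique because positive square roots are; the value for other `T` is irrelevant. -/
def asymptoticRoot (T : H →L[ℂ] H) : H →L[ℂ] H :=
  if hP : ∃ P : H →L[ℂ] H, P.IsPositive ∧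
      ∀ h, Tendsto (fun k : ℕ => (T ^ k * (ContinuousLinearMap.adjoint T) ^ k) h) atTop
        (𝓝 (P (P h)))
  then hP.choose else 0

theorem asymptoticRoot_spec (T : H →L[ℂ] H) (hT : ‖T‖ ≤ 1) :
    (asymptoticRoot T).IsPositive ∧
      ∀ h, Tendsto (fun k : ℕ => (T ^ k * (ContinuousLinearMap.adjoint T) ^ k) h) atTop
        (𝓝 (asymptoticRoot T (asymptoticRoot T h))) := by
  have hP := exists_asymptoticRoot T hT
  rw [asymptoticRoot, dif_pos hP]
  exact hP.choose_spec

/-- The Hilbert space `closure (Ran 𝒫)`. -/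
abbrev asymptoticSpace (T : H →L[ℂ] H) : Submodule ℂ H :=
  (LinearMap.range (asymptoticRoot T).toLinearMap).topologicalClosure

/-- `𝒫`, regarded as an operator into `closure (Ran 𝒫)`. -/
def toAsymptoticSpace (T : H →L[ℂ] H) : H →L[ℂ] asymptoticSpace T :=
  (asymptoticRoot T).codRestrict (asymptoticSpace T)
    (fun h => Submodule.le_topologicalClosure _ (LinearMap.mem_range_self _ h))

theorem denseRange_toAsymptoticSpace (T : H →L[ℂ] H) : DenseRange (toAsymptoticSpace T) := by
  rw [DenseRange, Subtype.dense_iff]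
  intro x hx
  rw [← Set.range_comp]
  exact hx

/-- The bounded operator on `closure (Ran 𝒫)`, `𝒫` being formed from `T`, that is densely defined by
`𝒫 h ↦ 𝒫 (A* h)`. -/
def inducedAdjoint (T A : H →L[ℂ] H) : asymptoticSpace T →L[ℂ] asymptoticSpace T :=
  LinearMap.extendOfNorm
    ((toAsymptoticSpace T).comp (ContinuousLinearMap.adjoint A)).toLinearMap
    (toAsymptoticSpace T).toLinearMap

/-- If `A` commutes with the contraction `T`, the induced operator really is well defined, bounded,
and given by its defining formula. -/
theorem inducedAdjoint_apply (T A : H →L[ℂ] H) (hT : ‖T‖ ≤ 1) (hA : Commute A T) (h : H) :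
    inducedAdjoint T A (toAsymptoticSpace T h)
      = toAsymptoticSpace T (ContinuousLinearMap.adjoint A h) := by
  obtain ⟨hpos, hlim⟩ := asymptoticRoot_spec T hT
  have hnorm : ∀ x : H, Tendsto (fun k : ℕ => ‖((ContinuousLinearMap.adjoint T) ^ k) x‖ ^ 2) atTop
      (𝓝 (‖asymptoticRoot T x‖ ^ 2)) := by
    intro x
    have h1 : Tendsto (fun k : ℕ => RCLike.re (inner ℂ
        ((T ^ k * (ContinuousLinearMap.adjoint T) ^ k) x) x)) atTop
        (𝓝 (RCLike.re (inner ℂ (asymptoticRoot T (asymptoticRoot T x)) x))) :=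
      (RCLike.continuous_re.tendsto _).comp ((hlim x).inner tendsto_const_nhds)
    have h2 : RCLike.re (inner ℂ (asymptoticRoot T (asymptoticRoot T x)) x)
        = ‖asymptoticRoot T x‖ ^ 2 := by
      rw [hpos.inner_left_eq_inner_right]
      exact inner_self_eq_norm_sq (𝕜 := ℂ) _
    rw [h2] at h1
    refine h1.congr fun k => ?_
    have h3 : T ^ k = ContinuousLinearMap.adjoint ((ContinuousLinearMap.adjoint T) ^ k) := by
      rw [← ContinuousLinearMap.star_eq_adjoint, star_pow, ContinuousLinearMap.star_eq_adjoint,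
        ContinuousLinearMap.adjoint_adjoint]
    conv_lhs => rw [h3]
    rw [mul_apply_eq_comp, ContinuousLinearMap.adjoint_inner_left]
    exact inner_self_eq_norm_sq (𝕜 := ℂ) _
  have hcomm : ∀ (k : ℕ) (x : H), ((ContinuousLinearMap.adjoint T) ^ k)
      (ContinuousLinearMap.adjoint A x)
        = ContinuousLinearMap.adjoint A (((ContinuousLinearMap.adjoint T) ^ k) x) := by
    intro k x
    have h1 : Commute (ContinuousLinearMap.adjoint A) (ContinuousLinearMap.adjoint T) := by
      rw [← ContinuousLinearMap.star_eq_adjoint, ← ContinuousLinearMap.star_eq_adjoint]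
      exact hA.star_star
    rw [← mul_apply_eq_comp, ← mul_apply_eq_comp, (h1.pow_right k).eq]
  have hbound : ∀ x : H, ‖asymptoticRoot T (ContinuousLinearMap.adjoint A x)‖
      ≤ ‖ContinuousLinearMap.adjoint A‖ * ‖asymptoticRoot T x‖ := by
    intro x
    refine le_of_sq_le_sq ?_ (by positivity)
    rw [mul_pow]
    refine le_of_tendsto_of_tendsto' (hnorm _) ((hnorm x).const_mul _) fun k => ?_
    rw [hcomm, ← mul_pow]
    gcongr
    exact ContinuousLinearMap.le_opNorm _ _
  exact LinearMap.extendOfNorm_eq (f := ((toAsymptoticSpace T).comp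
    (ContinuousLinearMap.adjoint A)).toLinearMap) (e := (toAsymptoticSpace T).toLinearMap)
    (denseRange_toAsymptoticSpace T) ⟨_, hbound⟩ h

/-! ### The canonical `Γₙ`-unitary -/

/-- `W` on `K` is the minimal unitary extension of the isometry `V` on `E`, where `E` is identified
with a closed subspace of `K` through the isometric embedding `ι`: it is a unitary extension of `V`,
and `K` is the smallest closed reducing subspace for `W` containing `E`. -/
structure IsMinimalUnitaryExtension {E : Type*} [NormedAddCommGroup E] [InnerProductSpace ℂ E]
    (V : E →L[ℂ] E) (ι : E →ₗᵢ[ℂ] K) (W : K →L[ℂ] K) : Prop where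
  isUnitary : W ∈ unitary (K →L[ℂ] K)
  extension : ∀ x, W (ι x) = ι (V x)
  minimal : ∀ M : Submodule ℂ K, IsClosed (M : Set K) → (∀ x, ι x ∈ M) →
    (∀ y ∈ M, W y ∈ M) → (∀ y ∈ M, ContinuousLinearMap.adjoint W y ∈ M) → M = ⊤

/-- `(D₁, …, Dₙ)` on `K` is the canonical `Γₙ`-unitary associated with the `Γₙ`-contraction
`(S₁, …, Sₙ)`: it is a `Γₙ`-unitary, `(D₁*, …, Dₙ*)` extends the tuple of operators
`𝒫 h ↦ 𝒫 (Sᵢ* h)` on `closure (Ran 𝒫) ⊆ K`, and `Dₙ*` is the minimal unitary extension of the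
isometry `𝒫 h ↦ 𝒫 (Sₙ* h)`. The inclusion of `closure (Ran 𝒫)` into `K` is `ι`. -/
structure IsCanonicalGammaUnitary (hn : 2 ≤ n) (S : Fin n → H →L[ℂ] H)
    (ι : asymptoticSpace (S (lastIdx n hn)) →ₗᵢ[ℂ] K) (D : Fin n → K →L[ℂ] K) : Prop where
  isGammaUnitary : IsGammaUnitary D
  extension : ∀ i x, ContinuousLinearMap.adjoint (D i) (ι x)
    = ι (inducedAdjoint (S (lastIdx n hn)) (S i) x)
  minimal : IsMinimalUnitaryExtension
    (inducedAdjoint (S (lastIdx n hn)) (S (lastIdx n hn))) ι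
    (ContinuousLinearMap.adjoint (D (lastIdx n hn)))

/-- The tuples `T` and `T'` are unitarily equivalent through the unitary `U`. -/
def UnitarilyEquivalentVia (U : H ≃ₗᵢ[ℂ] K) (T : Fin n → H →L[ℂ] H) (T' : Fin n → K →L[ℂ] K) :
    Prop :=
  ∀ i h, U (T i h) = T' i (U h)

end GammaN

end

/-! Write `P` for the asymptotic root of `Sₙ`. Minimality makes the vectors `Dₙ^k ι P h` total in
`K` (`closure_span_eq_top`), so a bounded operator is determined by its values on them; this gives
uniqueness.

For existence it suffices that these vectors and their primed counterparts have the same Gram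
matrix. Since `Dₙ` is unitary and `Dₙ*` extends `P h ↦ P Sₙ* h`, the inner product of `Dₙ^k ι P h`
and `Dₙ^(k+m) ι P g` is `⟪P Sₙ*^m h, P g⟫` (`inner_pow_pow_add`). This is a limit of inner products
`⟪Sₙ*^j x, Sₙ*^j y⟫`, which `U` preserves.

For the intertwining, `Dᵢ*` commutes with `Dₙ^k`, so it sends `Dₙ^k ι P h` to `Dₙ^k ι P Sᵢ* h`.
Hence `U_D` intertwines the adjoints on a total set, and being unitary it then intertwines the
operators themselves. -/

/-- Two families with the same Gram matrix and with dense spans are carried onto each other by a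
unitary operator. -/
theorem exists_linearIsometryEquiv_of_inner_eq {α K K' : Type*}
    [NormedAddCommGroup K] [InnerProductSpace ℂ K] [CompleteSpace K]
    [NormedAddCommGroup K'] [InnerProductSpace ℂ K'] [CompleteSpace K']
    (v : α → K) (v' : α → K') (hv : (Submodule.span ℂ (Set.range v)).topologicalClosure = ⊤)
    (hv' : (Submodule.span ℂ (Set.range v')).topologicalClosure = ⊤)
    (hinner : ∀ a b, inner ℂ (v' a) (v' b) = inner ℂ (v a) (v b)) :
    ∃ W : K ≃ₗᵢ[ℂ] K', ∀ a, W (v a) = v' a := by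
  have hdense : DenseRange (Finsupp.linearCombination ℂ v) := by
    rw [DenseRange, ← LinearMap.coe_range, Finsupp.range_linearCombination]
    exact Submodule.dense_iff_topologicalClosure_eq_top.mpr hv
  have hdense' : DenseRange (Finsupp.linearCombination ℂ v') := by
    rw [DenseRange, ← LinearMap.coe_range, Finsupp.range_linearCombination]
    exact Submodule.dense_iff_topologicalClosure_eq_top.mpr hv'
  -- The squared norm of a finite combination is a finite sum of Gram entries, so matching
  -- coefficients is isometric, and in particular well defined even when the families are linearly
  -- dependent.
  have hnorm : ∀ c : α →₀ ℂ,
      ‖Finsupp.linearCombination ℂ v' c‖ = ‖Finsupp.linearCombination ℂ v c‖ := by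
    intro c
    rw [@norm_eq_sqrt_re_inner ℂ, @norm_eq_sqrt_re_inner ℂ K]
    simp only [Finsupp.linearCombination_apply, Finsupp.sum, sum_inner, inner_sum,
      inner_smul_left, inner_smul_right, hinner]
  refine ⟨(LinearEquiv.refl ℂ (α →₀ ℂ)).extendOfIsometry _ _ hdense hdense' hnorm, fun a => ?_⟩
  simpa using (LinearEquiv.refl ℂ (α →₀ ℂ)).extendOfIsometry_eq _ _ hdense hdense' hnorm
    (Finsupp.single a 1)

/-- The star of an element commuting with a unitary commutes with that unitary. -/
theorem Commute.star_left_of_mem_unitary {R : Type*} [Monoid R] [StarMul R] {a u : R}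
    (h : Commute a u) (hu : u ∈ unitary R) : Commute (star a) u := by
  -- Unitarity replaces Fuglede's theorem here: insert `u* u` on the left, move `a` past `u`, and
  -- cancel `u u*`.
  have h1 : Commute a (star u) :=
    calc a * star u = star u * u * a * star u := by rw [Unitary.star_mul_self_of_mem hu, one_mul]
      _ = star u * a * (u * star u) := by rw [mul_assoc (star u), ← h.eq]; simp only [mul_assoc]
      _ = star u * a := by rw [Unitary.mul_star_self_of_mem hu, mul_one]
  simpa using h1.star_star

/-- A unitary operator that intertwines two operators also intertwines their adjoints. -/
theorem LinearIsometryEquiv.map_adjoint_apply_of_intertwines {H H' : Type*}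
    [NormedAddCommGroup H] [InnerProductSpace ℂ H] [CompleteSpace H]
    [NormedAddCommGroup H'] [InnerProductSpace ℂ H'] [CompleteSpace H']
    (U : H ≃ₗᵢ[ℂ] H') {A : H →L[ℂ] H} {A' : H' →L[ℂ] H'} (h : ∀ x, U (A x) = A' (U x)) (x : H) :
    U (ContinuousLinearMap.adjoint A x) = ContinuousLinearMap.adjoint A' (U x) := by
  refine ext_inner_right ℂ fun y => ?_
  obtain ⟨z, rfl⟩ := U.surjective y
  rw [U.inner_map_map, ContinuousLinearMap.adjoint_inner_left,
    ContinuousLinearMap.adjoint_inner_left, ← h, U.inner_map_map]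

/-- A unitary operator that intertwines two operators also intertwines the powers of their
adjoints. -/
theorem LinearIsometryEquiv.map_adjoint_pow_apply_of_intertwines {H H' : Type*}
    [NormedAddCommGroup H] [InnerProductSpace ℂ H] [CompleteSpace H]
    [NormedAddCommGroup H'] [InnerProductSpace ℂ H'] [CompleteSpace H']
    (U : H ≃ₗᵢ[ℂ] H') {A : H →L[ℂ] H} {A' : H' →L[ℂ] H'} (h : ∀ x, U (A x) = A' (U x))
    (k : ℕ) (x : H) :
    U ((ContinuousLinearMap.adjoint A ^ k) x) = (ContinuousLinearMap.adjoint A' ^ k) (U x) := by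
  induction k generalizing x with
  | zero => rfl
  | succ k ih =>
    rw [pow_succ, pow_succ, mul_apply_eq_comp, mul_apply_eq_comp, ih,
      U.map_adjoint_apply_of_intertwines h]

/-! ### The inner product induced by the asymptotic root -/

namespace GammaN

section

variable {H : Type*} [NormedAddCommGroup H] [InnerProductSpace ℂ H] [CompleteSpace H]

/-- Self-adjointness of `𝒫` turns `⟪𝒫 x, 𝒫 y⟫` into `⟪𝒫² x, y⟫`, to which the strong limit applies.
The inner product is thereby expressed through `T*` alone, without the square root. -/
theorem tendsto_inner_toAsymptoticSpace (T : H →L[ℂ] H) (hT : ‖T‖ ≤ 1) (x y : H) :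
    Tendsto (fun k : ℕ => (inner ℂ ((ContinuousLinearMap.adjoint T ^ k) x)
        ((ContinuousLinearMap.adjoint T ^ k) y) : ℂ)) atTop
      (𝓝 (inner ℂ (toAsymptoticSpace T x) (toAsymptoticSpace T y))) := by
  obtain ⟨hpos, hlim⟩ := asymptoticRoot_spec T hT
  have h2 : (inner ℂ (toAsymptoticSpace T x) (toAsymptoticSpace T y) : ℂ)
      = inner ℂ (asymptoticRoot T (asymptoticRoot T x)) y := by
    rw [hpos.inner_left_eq_inner_right]
    rfl
  rw [h2]
  refine ((hlim x).inner tendsto_const_nhds).congr fun k => ?_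
  have h3 : T ^ k = ContinuousLinearMap.adjoint (ContinuousLinearMap.adjoint T ^ k) := by
    rw [← ContinuousLinearMap.star_eq_adjoint, star_pow, ContinuousLinearMap.star_eq_adjoint,
      ContinuousLinearMap.adjoint_adjoint]
  conv_lhs => rw [h3]
  rw [mul_apply_eq_comp, ContinuousLinearMap.adjoint_inner_left]

variable {H' : Type*} [NormedAddCommGroup H'] [InnerProductSpace ℂ H'] [CompleteSpace H']

/-- Unitary equivalence of contractions carries the semi-inner product defined by `𝒫` over. -/
theorem inner_toAsymptoticSpace_map {T : H →L[ℂ] H} {T' : H' →L[ℂ] H'} (hT : ‖T‖ ≤ 1)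
    (hT' : ‖T'‖ ≤ 1) (U : H ≃ₗᵢ[ℂ] H') (hU : ∀ x, U (T x) = T' (U x)) (x y : H) :
    (inner ℂ (toAsymptoticSpace T' (U x)) (toAsymptoticSpace T' (U y)) : ℂ)
      = inner ℂ (toAsymptoticSpace T x) (toAsymptoticSpace T y) := by
  refine tendsto_nhds_unique (tendsto_inner_toAsymptoticSpace T' hT' (U x) (U y)) ?_
  refine (tendsto_inner_toAsymptoticSpace T hT x y).congr fun k => ?_
  rw [← U.map_adjoint_pow_apply_of_intertwines hU, ← U.map_adjoint_pow_apply_of_intertwines hU,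
    U.inner_map_map]

end

/-! ### The total family `Dₙ^k ι P h` of a canonical `Γₙ`-unitary -/

namespace IsCanonicalGammaUnitary

variable {n : ℕ} {hn : 2 ≤ n}
  {H : Type*} [NormedAddCommGroup H] [InnerProductSpace ℂ H] [CompleteSpace H]
  {K : Type*} [NormedAddCommGroup K] [InnerProductSpace ℂ K] [CompleteSpace K]
  {S : Fin n → H →L[ℂ] H} {ι : asymptoticSpace (S (lastIdx n hn)) →ₗᵢ[ℂ] K}
  {D : Fin n → K →L[ℂ] K}

theorem last_mem_unitary (hD : IsCanonicalGammaUnitary hn S ι D) :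
    D (lastIdx n hn) ∈ unitary (K →L[ℂ] K) := by
  have h := hD.minimal.isUnitary
  rwa [← ContinuousLinearMap.star_eq_adjoint, Unitary.star_mem_iff] at h

theorem adjoint_apply_embedding (hS : IsGammaContraction S)
    (hD : IsCanonicalGammaUnitary hn S ι D) (i : Fin n) (h : H) :
    ContinuousLinearMap.adjoint (D i) (ι (toAsymptoticSpace (S (lastIdx n hn)) h))
      = ι (toAsymptoticSpace (S (lastIdx n hn)) (ContinuousLinearMap.adjoint (S i) h)) := by
  rw [hD.extension, inducedAdjoint_apply _ _ (hS.norm_last_le_one hn) (hS.commute _ _)]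

/-- `Dᵢ*` commutes with the unitary `Dₙ`, so it passes through the power and reaches the embedded
space, where it is known. The total family is thus mapped into itself. -/
theorem adjoint_apply_pow_embedding (hS : IsGammaContraction S)
    (hD : IsCanonicalGammaUnitary hn S ι D) (i : Fin n) (k : ℕ) (h : H) :
    ContinuousLinearMap.adjoint (D i)
        ((D (lastIdx n hn) ^ k) (ι (toAsymptoticSpace (S (lastIdx n hn)) h)))
      = (D (lastIdx n hn) ^ k)
        (ι (toAsymptoticSpace (S (lastIdx n hn)) (ContinuousLinearMap.adjoint (S i) h))) := by
  have hc := ((hD.isGammaUnitary.commute i (lastIdx n hn)).star_left_of_mem_unitary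
    hD.last_mem_unitary).pow_right k
  rw [← hD.adjoint_apply_embedding hS, ← mul_apply_eq_comp, ← mul_apply_eq_comp,
    ← ContinuousLinearMap.star_eq_adjoint, hc.eq]

theorem closure_span_eq_top (hS : IsGammaContraction S)
    (hD : IsCanonicalGammaUnitary hn S ι D) :
    (Submodule.span ℂ (Set.range fun p : ℕ × H =>
      (D (lastIdx n hn) ^ p.1)
        (ι (toAsymptoticSpace (S (lastIdx n hn)) p.2)))).topologicalClosure = ⊤ := by
  set M := (Submodule.span ℂ (Set.range fun p : ℕ × H =>
      (D (lastIdx n hn) ^ p.1)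
        (ι (toAsymptoticSpace (S (lastIdx n hn)) p.2)))).topologicalClosure with hM
  have hclosed : IsClosed (M : Set K) := Submodule.isClosed_topologicalClosure _
  have hmem : ∀ (k : ℕ) (h : H),
      (D (lastIdx n hn) ^ k) (ι (toAsymptoticSpace (S (lastIdx n hn)) h)) ∈ M := fun k h =>
    Submodule.le_topologicalClosure _ (Submodule.subset_span ⟨(k, h), rfl⟩)
  -- As `M` is closed, invariance under a bounded operator need only be checked on the generators.
  have hinv : ∀ A : K →L[ℂ] K, (∀ (k : ℕ) (h : H),
      A ((D (lastIdx n hn) ^ k) (ι (toAsymptoticSpace (S (lastIdx n hn)) h))) ∈ M) →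
      ∀ y ∈ M, A y ∈ M := by
    intro A hA
    have hle : M ≤ M.comap A.toLinearMap := by
      refine Submodule.topologicalClosure_minimal _ (Submodule.span_le.mpr ?_)
        (hclosed.preimage A.continuous)
      rintro _ ⟨p, rfl⟩
      exact hA p.1 p.2
    exact fun y hy => hle hy
  refine hD.minimal.minimal M hclosed ?_ (hinv _ fun k h => ?_) (hinv _ fun k h => ?_)
  · intro x
    refine (denseRange_toAsymptoticSpace _).induction_on x (hclosed.preimage ι.continuous) ?_
    intro h
    exact hmem 0 h
  -- `Dₙ*` is absorbed into `h` instead of lowering the exponent, so `k = 0` needs no separate case.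
  · rw [hD.adjoint_apply_pow_embedding hS]
    exact hmem k _
  · rw [ContinuousLinearMap.adjoint_adjoint, ← mul_apply_eq_comp, ← pow_succ']
    exact hmem (k + 1) h

/-- The common power `k` cancels because `Dₙ` is isometric; the remaining `m` factors cross over as
`Dₙ*` and become `Sₙ*` under `P`. Neither `D` nor `ι` survives on the right, so the Gram matrix
depends on `Sₙ` only. -/
theorem inner_pow_pow_add (hS : IsGammaContraction S)
    (hD : IsCanonicalGammaUnitary hn S ι D) (k m : ℕ) (h g : H) :
    (inner ℂ ((D (lastIdx n hn) ^ k) (ι (toAsymptoticSpace (S (lastIdx n hn)) h)))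
      ((D (lastIdx n hn) ^ (k + m)) (ι (toAsymptoticSpace (S (lastIdx n hn)) g))) : ℂ)
      = inner ℂ (toAsymptoticSpace (S (lastIdx n hn))
          ((ContinuousLinearMap.adjoint (S (lastIdx n hn)) ^ m) h))
        (toAsymptoticSpace (S (lastIdx n hn)) g) := by
  have hiso : ∀ x y, inner ℂ (D (lastIdx n hn) x) (D (lastIdx n hn) y) = (inner ℂ x y : ℂ) :=
    fun x y => by
      rw [← ContinuousLinearMap.adjoint_inner_left, ← mul_apply_eq_comp,
        ← ContinuousLinearMap.star_eq_adjoint, Unitary.star_mul_self_of_mem hD.last_mem_unitary]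
      rfl
  induction k generalizing h g with
  | succ k ih =>
    rw [← ih, add_right_comm, pow_succ', pow_succ', mul_apply_eq_comp, mul_apply_eq_comp, hiso]
  | zero =>
    rw [zero_add, pow_zero, one_apply_eq_self]
    -- Each factor moved across replaces `h` by `Sₙ* h`, so `h` has to vary in the induction.
    induction m generalizing h with
    | zero => exact ι.inner_map_map _ _
    | succ m ih =>
      rw [pow_succ', mul_apply_eq_comp, ← ContinuousLinearMap.adjoint_inner_left,
        hD.adjoint_apply_embedding hS, ih, pow_succ, mul_apply_eq_comp]

end IsCanonicalGammaUnitary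

end GammaN

/-! ### Construction of `U_D`, uniqueness and intertwining -/

open GammaN in
theorem theorem2p6 {n : ℕ} (hn : 2 ≤ n)
    {H : Type*} [NormedAddCommGroup H] [InnerProductSpace ℂ H] [CompleteSpace H]
    {H' : Type*} [NormedAddCommGroup H'] [InnerProductSpace ℂ H'] [CompleteSpace H']
    {K : Type*} [NormedAddCommGroup K] [InnerProductSpace ℂ K] [CompleteSpace K]
    {K' : Type*} [NormedAddCommGroup K'] [InnerProductSpace ℂ K'] [CompleteSpace K']
    (S : Fin n → H →L[ℂ] H) (S' : Fin n → H' →L[ℂ] H')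
    (hS : GammaN.IsGammaContraction S) (hS' : GammaN.IsGammaContraction S')
    (ι : GammaN.asymptoticSpace (S (GammaN.lastIdx n hn)) →ₗᵢ[ℂ] K) (D : Fin n → K →L[ℂ] K)
    (hD : GammaN.IsCanonicalGammaUnitary hn S ι D)
    (ι' : GammaN.asymptoticSpace (S' (GammaN.lastIdx n hn)) →ₗᵢ[ℂ] K') (D' : Fin n → K' →L[ℂ] K')
    (hD' : GammaN.IsCanonicalGammaUnitary hn S' ι' D')
    (U : H ≃ₗᵢ[ℂ] H') (hU : GammaN.UnitarilyEquivalentVia U S S') :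
    ∃ UD : K ≃ₗᵢ[ℂ] K',
      (∀ (k : ℕ) (h : H),
        UD ((D (GammaN.lastIdx n hn) ^ k)
            (ι (GammaN.toAsymptoticSpace (S (GammaN.lastIdx n hn)) h)))
          = (D' (GammaN.lastIdx n hn) ^ k)
            (ι' (GammaN.toAsymptoticSpace (S' (GammaN.lastIdx n hn)) (U h)))) ∧
      (∀ W : K →L[ℂ] K',
        (∀ (k : ℕ) (h : H),
          W ((D (GammaN.lastIdx n hn) ^ k)
              (ι (GammaN.toAsymptoticSpace (S (GammaN.lastIdx n hn)) h)))
            = (D' (GammaN.lastIdx n hn) ^ k)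
              (ι' (GammaN.toAsymptoticSpace (S' (GammaN.lastIdx n hn)) (U h)))) →
        ∀ x, W x = UD x) ∧
      GammaN.UnitarilyEquivalentVia UD D D' := by
  have hadd : ∀ (k m : ℕ) (h g : H),
      (inner ℂ ((D' (lastIdx n hn) ^ k)
          (ι' (toAsymptoticSpace (S' (lastIdx n hn)) (U h))))
        ((D' (lastIdx n hn) ^ (k + m))
          (ι' (toAsymptoticSpace (S' (lastIdx n hn)) (U g)))) : ℂ)
        = inner ℂ ((D (lastIdx n hn) ^ k) (ι (toAsymptoticSpace (S (lastIdx n hn)) h)))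
          ((D (lastIdx n hn) ^ (k + m))
            (ι (toAsymptoticSpace (S (lastIdx n hn)) g))) := by
    intro k m h g
    rw [hD.inner_pow_pow_add hS, hD'.inner_pow_pow_add hS',
      ← U.map_adjoint_pow_apply_of_intertwines (hU _),
      inner_toAsymptoticSpace_map (hS.norm_last_le_one hn) (hS'.norm_last_le_one hn) U
        (hU _)]
  have hinner : ∀ p q : ℕ × H,
      (inner ℂ ((D' (lastIdx n hn) ^ p.1)
          (ι' (toAsymptoticSpace (S' (lastIdx n hn)) (U p.2))))
        ((D' (lastIdx n hn) ^ q.1)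
          (ι' (toAsymptoticSpace (S' (lastIdx n hn)) (U q.2)))) : ℂ)
        = inner ℂ ((D (lastIdx n hn) ^ p.1) (ι (toAsymptoticSpace (S (lastIdx n hn)) p.2)))
          ((D (lastIdx n hn) ^ q.1) (ι (toAsymptoticSpace (S (lastIdx n hn)) q.2))) := by
    rintro ⟨k, h⟩ ⟨l, g⟩
    rcases le_total k l with hkl | hkl
    · obtain ⟨m, rfl⟩ := Nat.exists_eq_add_of_le hkl
      exact hadd k m h g
    · obtain ⟨m, rfl⟩ := Nat.exists_eq_add_of_le hkl
      -- The case of the larger exponent on the left follows by conjugate symmetry.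
      rw [← inner_conj_symm, hadd l m g h, inner_conj_symm]
  have hspan := hD.closure_span_eq_top hS
  have hspan' : (Submodule.span ℂ (Set.range fun p : ℕ × H =>
      (D' (lastIdx n hn) ^ p.1)
          (ι' (toAsymptoticSpace (S' (lastIdx n hn)) (U p.2))))).topologicalClosure
      = ⊤ := by
    -- Since `U` is onto, replacing `h'` by `U h` only reindexes the total family of `D'`.
    rw [← hD'.closure_span_eq_top hS', ← ((Equiv.refl ℕ).prodCongr U.toEquiv).surjective.range_comp]
    rfl
  obtain ⟨UD, hUD⟩ := exists_linearIsometryEquiv_of_inner_eq _ _ hspan hspan' hinner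
  have hext : ∀ A B : K →L[ℂ] K', (∀ (k : ℕ) (h : H),
      A ((D (lastIdx n hn) ^ k) (ι (toAsymptoticSpace (S (lastIdx n hn)) h)))
        = B ((D (lastIdx n hn) ^ k) (ι (toAsymptoticSpace (S (lastIdx n hn)) h)))) → A = B := by
    intro A B hAB
    refine ContinuousLinearMap.ext_on
      (Submodule.dense_iff_topologicalClosure_eq_top.mpr hspan) ?_
    rintro _ ⟨p, rfl⟩
    exact hAB p.1 p.2
  have hUD' : ∀ (k : ℕ) (h : H),
      UD ((D (lastIdx n hn) ^ k) (ι (toAsymptoticSpace (S (lastIdx n hn)) h)))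
      = (D' (lastIdx n hn) ^ k)
          (ι' (toAsymptoticSpace (S' (lastIdx n hn)) (U h))) :=
    fun k h => hUD (k, h)
  refine ⟨UD, hUD', fun W hW x => ?_, fun i x => ?_⟩
  · exact DFunLike.congr_fun (hext W (UD : K →L[ℂ] K') fun k h => (hW k h).trans (hUD' k h).symm) x
  -- The extension property describes `Dᵢ*`, not `Dᵢ`, on the embedded space, so the adjoints are
  -- intertwined first.
  · have hadj : ∀ y, UD (ContinuousLinearMap.adjoint (D i) y)
        = ContinuousLinearMap.adjoint (D' i) (UD y) := by
      refine DFunLike.congr_fun (hext ((UD : K →L[ℂ] K').comp (ContinuousLinearMap.adjoint (D i)))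
        ((ContinuousLinearMap.adjoint (D' i)).comp (UD : K →L[ℂ] K')) fun k h => ?_)
      change UD (ContinuousLinearMap.adjoint (D i) _) = ContinuousLinearMap.adjoint (D' i) (UD _)
      rw [hD.adjoint_apply_pow_embedding hS, hUD', hUD', hD'.adjoint_apply_pow_embedding hS',
        U.map_adjoint_apply_of_intertwines (hU i)]
    simpa only [ContinuousLinearMap.adjoint_adjoint] using
      UD.map_adjoint_apply_of_intertwines hadj x
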